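/- For $A\in M_n(\mathbb C)$ let $\sigma(A)=(\sigma_1(A),\dots,\sigma_n(A))$ be its singular values in decreasing order and $\|A\|_{(k)}=\sum_{i=1}^k\sigma_i(A)$ its Ky Fan norms. For $0\le k\le n$ define the $k$-th discrepancy norm $$\|A\|^{\delta}_{(k)}=\max\{\operatorname{Re}\operatorname{tr}(AM)\;:\;M\in M_n(\mathbb C),\ \|M\|_{(1)}\le 1,\ \|M\|_{(n)}\le k,\ \operatorname{tr}M=0\}$$ (so $\|A\|^\delta_{(0)}=0$), the discrepancy values $\delta_k(A)=\|A\|^{\delta}_{(k)}-\|A\|^{\delta}_{(k-1)}$, and the vector $\delta(A)=(\delta_1(A),\dots,\delta_n(A))$. For $x,y\in\mathbb R^n$ write $x\prec_w y$ if $\sum_{i=1}^k x_i^{\downarrow}\le\sum_{i=1}^k y_i^{\downarrow}$ for $k=1,\dots,n$, where $x^{\downarrow}$ is the decreasing rearrangement of $x$; products of vectors are taken entrywise, and $[A,B]=AB-BA$. **Theorem.** Let $A,B\in M_n(\mathbb C)$. 1. If $A$ is Hermitian (and $B$ is arbitrary), then $\sigma([A,B])\prec_w 2\,\delta(A)\,\delta(B)$.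 2. If $B$ is normal and its eigenvalues lie on a straight line in the complex plane (and $A$ is arbitrary), then $\sigma([B,A])\prec_w 2\,\delta(B)\,\delta(A)$. -/

import Mathlib

open scoped Matrix

noncomputable section

namespace Discrepancy

/-- The singular values `σ₁(A) ≥ σ₂(A) ≥ … ≥ σₙ(A) ≥ 0` of a square complex matrix, in decreasing
order, as a vector indexed by `Fin n` (so `singularValues A 0` is `σ₁(A)`). -/
def singularValues {n : ℕ} (A : Matrix (Fin n) (Fin n) ℂ) : Fin n → ℝ :=
  fun i => (Matrix.toEuclideanLin A).singularValues i

/-- The Ky Fan norm `‖A‖₍ₖ₎`: the sum of the `k` largest singular values. -/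
def kyFanNorm {n : ℕ} (k : ℕ) (A : Matrix (Fin n) (Fin n) ℂ) : ℝ :=
  ∑ i : Fin n with i.val < k, singularValues A i

/-- The traceless matrices `M` with `‖M‖₍₁₎ ≤ 1` and `‖M‖₍ₙ₎ ≤ k`, i.e. the traceless contractions
of trace norm at most `k`. -/
def tracelessBall (n k : ℕ) : Set (Matrix (Fin n) (Fin n) ℂ) :=
  {M | kyFanNorm 1 M ≤ 1 ∧ kyFanNorm n M ≤ k ∧ M.trace = 0}

/-- The `k`-th discrepancy (pseudo-)norm of `A`: the maximum of `Re tr (A M)` over the (compact,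
nonempty) set `tracelessBall n k`. It is `0` for `k = 0`, as then `M = 0` is the only competitor. -/
def discrepancyNorm {n : ℕ} (k : ℕ) (A : Matrix (Fin n) (Fin n) ℂ) : ℝ :=
  sSup ((fun M => (A * M).trace.re) '' tracelessBall n k)

/-- The vector `δ(A) = (δ₁(A), …, δₙ(A))` of discrepancy values: the differences of consecutive
discrepancy norms. -/
def discrepancyValues {n : ℕ} (A : Matrix (Fin n) (Fin n) ℂ) : Fin n → ℝ :=
  fun i => discrepancyNorm (i.val + 1) A - discrepancyNorm i.val A

/-- The decreasing rearrangement `x↓` of a real vector. -/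
def decreasing {n : ℕ} (x : Fin n → ℝ) : Fin n → ℝ :=
  x ∘ Tuple.sort (OrderDual.toDual ∘ x)

theorem decreasing_antitone {n : ℕ} (x : Fin n → ℝ) : Antitone (decreasing x) :=
  fun _ _ h => Tuple.monotone_sort (OrderDual.toDual ∘ x) h

/-- Weak majorization `x ≺_w y`: for each `k = 1, …, n` the sum of the `k` largest entries of `x`
is at most the sum of the `k` largest entries of `y`. -/
def WeaklyMajorizedBy {n : ℕ} (x y : Fin n → ℝ) : Prop :=
  ∀ k : ℕ, 1 ≤ k → k ≤ n →
    ∑ i : Fin n with i.val < k, decreasing x i ≤ ∑ i : Fin n with i.val < k, decreasing y i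

end Discrepancy

end

section

open scoped Matrix.Norms.L2Operator

namespace Discrepancy

variable {n : ℕ}

/-! Up to a scalar and a phase `z`, the first factor is a layered sum of nested spectral projections
`E` with weights `g i ≥ 0`, the eigenvalue gaps. Let `U` attain the Ky Fan norm of the commutator;
moving the commutator from `B` to `U` leaves terms tr(B[zU, E]). For `E` of rank `p`, [zU, E] is a
traceless contraction of trace norm at most min(k, 2 min(p, n - p)), so each term is at most a
discrepancy norm of `B` (`commutator_spectralProj_mem_tracelessBall`).

Summing by layers gives ∑ aⱼ δⱼ(B). The partial sums of a are at most those of 2δ(A), as testing `A`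
against differences of its top and bottom spectral projections shows
(`sum_min_le_two_mul_discrepancyNorm`). Since δ(B) is nonnegative and decreasing, Abel summation
finishes.

Trace norm bounds are used in the dual form |tr(MW)| ≤ k‖W‖, which turns them into triangle
inequalities. -/

/-! ### Singular values and trace duality -/

/-- The matrix whose columns are the vectors of an orthonormal basis is unitary. -/
theorem orthonormalBasis_columns_mem_unitary
    (b : OrthonormalBasis (Fin n) ℂ (EuclideanSpace ℂ (Fin n))) :
    Matrix.of (fun i j => b j i) ∈ unitary (Matrix (Fin n) (Fin n) ℂ) := by
  rw [← Matrix.unitaryGroup, Matrix.mem_unitaryGroup_iff']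
  ext i j
  have h := orthonormal_iff_ite.mp b.orthonormal i j
  rw [PiLp.inner_apply] at h
  simp only [RCLike.inner_apply] at h
  simp only [Matrix.star_eq_conjTranspose, Matrix.mul_apply, Matrix.conjTranspose_apply,
    Matrix.of_apply, Matrix.one_apply, ← h]
  exact Finset.sum_congr rfl fun k _ => mul_comm _ _

/-- Singular value decomposition of a square complex matrix. -/
theorem exists_singularValueDecomposition (A : Matrix (Fin n) (Fin n) ℂ) :
    ∃ P ∈ unitary (Matrix (Fin n) (Fin n) ℂ), ∃ Q ∈ unitary (Matrix (Fin n) (Fin n) ℂ),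
      A = P * Matrix.diagonal (fun i => (singularValues A i : ℂ)) * star Q := by
  classical
  have hn : Module.finrank ℂ (EuclideanSpace ℂ (Fin n)) = n := by simp
  set T := Matrix.toEuclideanLin A with hT
  let b := T.isSymmetric_adjoint_comp_self.eigenvectorBasis hn
  have hb (i j : Fin n) : inner ℂ (T (b i)) (T (b j)) =
      if i = j then ((singularValues A j : ℂ)) ^ 2 else 0 := by
    rw [← LinearMap.adjoint_inner_right, ← LinearMap.comp_apply,
      T.isSymmetric_adjoint_comp_self.apply_eigenvectorBasis hn j, inner_smul_right,
      orthonormal_iff_ite.mp b.orthonormal i j, ← T.sq_singularValues_fin hn j]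
    split_ifs <;> simp [singularValues, hT]
  let v : Fin n → EuclideanSpace ℂ (Fin n) := fun i => (singularValues A i : ℂ)⁻¹ • T (b i)
  have hv : Orthonormal ℂ (Set.domRestrict {i | singularValues A i ≠ 0} v) := by
    rw [orthonormal_iff_ite]
    rintro ⟨i, hi⟩ ⟨j, hj⟩
    have hj' : (singularValues A j : ℂ) ≠ 0 := by exact_mod_cast hj
    simp only [Set.domRestrict_apply, v, inner_smul_left, inner_smul_right, hb, Subtype.mk.injEq]
    split_ifs with h
    · subst h
      simp only [map_inv₀, Complex.conj_ofReal]
      field_simp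
    · simp
  -- Where the singular value vanishes, `v` is zero and `c` is an arbitrary completion; this is
  -- harmless because `T (b j) = 0` there.
  obtain ⟨c, hc⟩ := hv.exists_orthonormalBasis_extension_of_card_eq (by simp)
  have hcb (j : Fin n) : T (b j) = (singularValues A j : ℂ) • c j := by
    by_cases hj : singularValues A j = 0
    · have h := hb j j
      rw [if_pos rfl, hj] at h
      simpa [hj] using h
    · have hj' : (singularValues A j : ℂ) ≠ 0 := by exact_mod_cast hj
      rw [hc j hj, smul_inv_smul₀ hj']
  refine ⟨_, orthonormalBasis_columns_mem_unitary c, _, orthonormalBasis_columns_mem_unitary b, ?_⟩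
  have hQ := Unitary.mul_star_self_of_mem (orthonormalBasis_columns_mem_unitary b)
  have key : A * Matrix.of (fun i j => b j i) = Matrix.of (fun i j => c j i) *
      Matrix.diagonal (fun i => (singularValues A i : ℂ)) := by
    ext i j
    have h := congrArg (fun x : EuclideanSpace ℂ (Fin n) => x i) (hcb j)
    simp only [hT, Matrix.toLpLin_apply, PiLp.smul_apply, smul_eq_mul] at h
    rw [Matrix.mul_diagonal, Matrix.of_apply, mul_comm, ← h]
    rfl
  rw [← key, mul_assoc, hQ, mul_one]

theorem norm_apply_le (W : Matrix (Fin n) (Fin n) ℂ) (i : Fin n) : ‖W i i‖ ≤ ‖W‖ := by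
  have h := Matrix.l2_opNorm_mulVec W (EuclideanSpace.single i 1)
  simp only [PiLp.ofLp_single, Matrix.mulVec_single_one, PiLp.norm_single, norm_one,
    mul_one] at h
  exact (PiLp.norm_apply_le (WithLp.toLp 2 (W.col i)) i).trans h

theorem norm_unitary_diagonal_unitary_le {P Q : Matrix (Fin n) (Fin n) ℂ}
    (hP : P ∈ unitary (Matrix (Fin n) (Fin n) ℂ)) (hQ : Q ∈ unitary (Matrix (Fin n) (Fin n) ℂ))
    {d : Fin n → ℂ} {c : ℝ} (hc : 0 ≤ c) (hd : ∀ i, ‖d i‖ ≤ c) :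
    ‖P * Matrix.diagonal d * Q‖ ≤ c := by
  rw [CStarRing.norm_mul_mem_unitary _ hQ, CStarRing.norm_mem_unitary_mul _ hP,
    Matrix.l2_opNorm_diagonal]
  exact (pi_norm_le_iff_of_nonneg hc).2 hd

/-- By cyclicity, `d` pairs with the diagonal of `Q * W * P`, whose entries are bounded by ‖W‖. -/
theorem norm_trace_unitary_diagonal_unitary_mul_le {P Q : Matrix (Fin n) (Fin n) ℂ}
    (hP : P ∈ unitary (Matrix (Fin n) (Fin n) ℂ)) (hQ : Q ∈ unitary (Matrix (Fin n) (Fin n) ℂ))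
    (d : Fin n → ℂ) (W : Matrix (Fin n) (Fin n) ℂ) :
    ‖(P * Matrix.diagonal d * Q * W).trace‖ ≤ (∑ i, ‖d i‖) * ‖W‖ := by
  rw [mul_assoc, mul_assoc, Matrix.trace_mul_comm, mul_assoc, Matrix.trace, Finset.sum_mul]
  refine (norm_sum_le _ _).trans (Finset.sum_le_sum fun i _ => ?_)
  rw [Matrix.diag_apply, Matrix.diagonal_mul, norm_mul]
  refine mul_le_mul_of_nonneg_left ((norm_apply_le _ i).trans ?_) (norm_nonneg _)
  rw [CStarRing.norm_mul_mem_unitary _ hP, CStarRing.norm_mem_unitary_mul _ hQ]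

theorem singularValues_nonneg (A : Matrix (Fin n) (Fin n) ℂ) (i : Fin n) :
    0 ≤ singularValues A i :=
  LinearMap.singularValues_nonneg _ _

theorem singularValues_antitone (A : Matrix (Fin n) (Fin n) ℂ) : Antitone (singularValues A) :=
  fun _ _ h => LinearMap.singularValues_antitone _ h

theorem kyFanNorm_self_eq_sum (A : Matrix (Fin n) (Fin n) ℂ) :
    kyFanNorm n A = ∑ i, singularValues A i := by
  simp [kyFanNorm]

/-- A Ky Fan norm is attained against a partial isometry of rank at most `k`. -/
theorem exists_trace_eq_kyFanNorm (k : ℕ) (A : Matrix (Fin n) (Fin n) ℂ) :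
    ∃ U : Matrix (Fin n) (Fin n) ℂ, ‖U‖ ≤ 1 ∧
      (∀ W : Matrix (Fin n) (Fin n) ℂ, ‖(U * W).trace‖ ≤ k * ‖W‖) ∧
      (A * U).trace = kyFanNorm k A := by
  obtain ⟨P, hP, Q, hQ, hA⟩ := exists_singularValueDecomposition A
  let d : Fin n → ℂ := fun i => if i.val < k then 1 else 0
  refine ⟨Q * Matrix.diagonal d * star P, ?_, fun W => ?_, ?_⟩
  · refine norm_unitary_diagonal_unitary_le hQ (Unitary.star_mem hP) zero_le_one fun i => ?_
    simp only [d]; split_ifs <;> simp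
  · refine (norm_trace_unitary_diagonal_unitary_mul_le hQ (Unitary.star_mem hP) d W).trans
      (mul_le_mul_of_nonneg_right ?_ (norm_nonneg W))
    have h (i : Fin n) : ‖d i‖ = if i.val < k then 1 else 0 := by
      simp only [d]; split_ifs <;> simp
    simp only [h, Finset.sum_boole, Nat.cast_le]
    rw [← Fintype.card_subtype]
    simpa using Fintype.card_le_of_injective
      (fun i : {i : Fin n // i.val < k} => (⟨i.1.1, i.2⟩ : Fin k)) fun a b h => by
        simpa [Fin.ext_iff, Subtype.ext_iff] using h
  · conv_lhs => rw [hA]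
    have : P * Matrix.diagonal (fun i => (singularValues A i : ℂ)) * star Q *
        (Q * Matrix.diagonal d * star P) =
        P * (Matrix.diagonal (fun i => (singularValues A i : ℂ)) * (star Q * Q) *
          Matrix.diagonal d * star P) := by simp only [mul_assoc]
    rw [this, Matrix.trace_mul_comm, mul_assoc, Unitary.star_mul_self_of_mem hQ,
      Unitary.star_mul_self_of_mem hP, mul_one, mul_one, Matrix.diagonal_mul_diagonal,
      Matrix.trace_diagonal, kyFanNorm, Finset.sum_filter]
    push_cast
    refine Finset.sum_congr rfl fun i _ => ?_
    simp only [d]; split_ifs <;> simp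

theorem kyFanNorm_le_of_forall_trace_le {k : ℕ} {A : Matrix (Fin n) (Fin n) ℂ} {c : ℝ}
    (h : ∀ W : Matrix (Fin n) (Fin n) ℂ, ‖W‖ ≤ 1 → ‖(A * W).trace‖ ≤ c) :
    kyFanNorm k A ≤ c := by
  obtain ⟨U, hU, -, hA⟩ := exists_trace_eq_kyFanNorm k A
  have h1 := h U hU
  rw [hA, Complex.norm_real] at h1
  exact (le_abs_self _).trans h1

theorem kyFanNorm_one_le_norm (A : Matrix (Fin n) (Fin n) ℂ) : kyFanNorm 1 A ≤ ‖A‖ := by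
  obtain ⟨U, -, hU, hA⟩ := exists_trace_eq_kyFanNorm 1 A
  have h1 := hU A
  rw [Matrix.trace_mul_comm, hA, Complex.norm_real] at h1
  simpa using (le_abs_self _).trans h1

theorem norm_trace_mul_le_kyFanNorm_mul (A W : Matrix (Fin n) (Fin n) ℂ) :
    ‖(A * W).trace‖ ≤ kyFanNorm n A * ‖W‖ := by
  obtain ⟨P, hP, Q, hQ, hA⟩ := exists_singularValueDecomposition A
  have h := norm_trace_unitary_diagonal_unitary_mul_le hP (Unitary.star_mem hQ)
    (fun i => (singularValues A i : ℂ)) W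
  rw [← hA] at h
  simpa [kyFanNorm_self_eq_sum, abs_of_nonneg (singularValues_nonneg A _)] using h

theorem norm_le_kyFanNorm_one (A : Matrix (Fin n) (Fin n) ℂ) : ‖A‖ ≤ kyFanNorm 1 A := by
  obtain ⟨P, hP, Q, hQ, hA⟩ := exists_singularValueDecomposition A
  conv_lhs => rw [hA]
  refine norm_unitary_diagonal_unitary_le hP (Unitary.star_mem hQ)
    (Finset.sum_nonneg fun i _ => singularValues_nonneg A i) fun i => ?_
  have hn : 0 < n := i.pos
  rw [Complex.norm_real, Real.norm_of_nonneg (singularValues_nonneg A i)]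
  exact (singularValues_antitone A (show (⟨0, hn⟩ : Fin n) ≤ i from Nat.zero_le _)).trans
    (Finset.single_le_sum (f := singularValues A) (fun j _ => singularValues_nonneg A j)
      (by simp))

/-- The constraints defining `tracelessBall` in terms of the operator norm and of duality. -/
theorem mem_tracelessBall_iff {k : ℕ} {M : Matrix (Fin n) (Fin n) ℂ} :
    M ∈ tracelessBall n k ↔ ‖M‖ ≤ 1 ∧
      (∀ W : Matrix (Fin n) (Fin n) ℂ, ‖(M * W).trace‖ ≤ k * ‖W‖) ∧ M.trace = 0 := by
  constructor
  · rintro ⟨h1, h2, h3⟩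
    exact ⟨(norm_le_kyFanNorm_one M).trans h1, fun W =>
      (norm_trace_mul_le_kyFanNorm_mul M W).trans
        (mul_le_mul_of_nonneg_right h2 (norm_nonneg W)), h3⟩
  · rintro ⟨h1, h2, h3⟩
    exact ⟨(kyFanNorm_one_le_norm M).trans h1, kyFanNorm_le_of_forall_trace_le fun W hW =>
      (h2 W).trans (mul_le_of_le_one_right (Nat.cast_nonneg k) hW), h3⟩

/-! ### Discrepancy norms: monotone and concave in `k` -/

theorem zero_mem_tracelessBall (n k : ℕ) : 0 ∈ tracelessBall n k :=
  mem_tracelessBall_iff.2 ⟨by simp, fun W => by simp; positivity, by simp⟩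

theorem discrepancyNorm_le {k : ℕ} {A : Matrix (Fin n) (Fin n) ℂ} {c : ℝ}
    (h : ∀ M ∈ tracelessBall n k, (A * M).trace.re ≤ c) : discrepancyNorm k A ≤ c := by
  refine csSup_le ⟨_, 0, zero_mem_tracelessBall n k, rfl⟩ ?_
  rintro _ ⟨M, hM, rfl⟩
  exact h M hM

theorem re_trace_mul_le_of_mem_tracelessBall {k : ℕ} {A M : Matrix (Fin n) (Fin n) ℂ}
    (hM : M ∈ tracelessBall n k) : (A * M).trace.re ≤ k * ‖A‖ := by
  rw [Matrix.trace_mul_comm]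
  exact (Complex.re_le_norm _).trans ((mem_tracelessBall_iff.1 hM).2.1 A)

theorem le_discrepancyNorm {k : ℕ} {A M : Matrix (Fin n) (Fin n) ℂ}
    (hM : M ∈ tracelessBall n k) : (A * M).trace.re ≤ discrepancyNorm k A := by
  refine le_csSup ⟨k * ‖A‖, ?_⟩ ⟨M, hM, rfl⟩
  rintro _ ⟨M, hM, rfl⟩
  exact re_trace_mul_le_of_mem_tracelessBall hM

theorem discrepancyNorm_zero (A : Matrix (Fin n) (Fin n) ℂ) : discrepancyNorm 0 A = 0 := by
  refine le_antisymm (discrepancyNorm_le fun M hM => ?_) ?_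
  · simpa using re_trace_mul_le_of_mem_tracelessBall (A := A) hM
  · simpa using le_discrepancyNorm (A := A) (zero_mem_tracelessBall n 0)

theorem tracelessBall_mono {k l : ℕ} (h : k ≤ l) : tracelessBall n k ⊆ tracelessBall n l :=
  fun _ hM => ⟨hM.1, hM.2.1.trans (by exact_mod_cast h), hM.2.2⟩

theorem discrepancyNorm_mono (A : Matrix (Fin n) (Fin n) ℂ) :
    Monotone fun k => discrepancyNorm k A :=
  fun _ _ h => discrepancyNorm_le fun _ hM => le_discrepancyNorm (tracelessBall_mono h hM)

theorem midpoint_mem_tracelessBall {j k l : ℕ} (h : j + l ≤ 2 * k)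
    {M N : Matrix (Fin n) (Fin n) ℂ} (hM : M ∈ tracelessBall n j) (hN : N ∈ tracelessBall n l) :
    (1 / 2 : ℂ) • (M + N) ∈ tracelessBall n k := by
  obtain ⟨hM1, hM2, hM3⟩ := mem_tracelessBall_iff.1 hM
  obtain ⟨hN1, hN2, hN3⟩ := mem_tracelessBall_iff.1 hN
  refine mem_tracelessBall_iff.2 ⟨?_, fun W => ?_, by simp [hM3, hN3]⟩
  · rw [norm_smul]
    have := norm_add_le M N
    norm_num
    linarith
  · rw [smul_mul_assoc, Matrix.trace_smul, norm_smul, add_mul, Matrix.trace_add]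
    have h1 := norm_add_le (M * W).trace (N * W).trace
    have h2 := hM2 W
    have h3 := hN2 W
    have h4 : ((j : ℝ) + l) * ‖W‖ ≤ 2 * k * ‖W‖ :=
      mul_le_mul_of_nonneg_right (by exact_mod_cast h) (norm_nonneg W)
    norm_num
    linarith

/-- Midpoints of competitors at levels `k` and `k + 2` compete at level `k + 1`. This is what makes
the discrepancy values decreasing. -/
theorem discrepancyNorm_concave (k : ℕ) (A : Matrix (Fin n) (Fin n) ℂ) :
    discrepancyNorm k A + discrepancyNorm (k + 2) A ≤ 2 * discrepancyNorm (k + 1) A := by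
  rw [← le_sub_iff_add_le]
  refine discrepancyNorm_le fun M hM => ?_
  rw [le_sub_comm]
  refine discrepancyNorm_le fun N hN => ?_
  have h := le_discrepancyNorm (A := A) (midpoint_mem_tracelessBall (k := k + 1) (by omega) hM hN)
  rw [mul_smul_comm, Matrix.trace_smul, mul_add, Matrix.trace_add] at h
  simp at h
  linarith

/-- The discrepancy values as a sequence indexed by `ℕ`. -/
noncomputable def discrepancySeq (A : Matrix (Fin n) (Fin n) ℂ) (k : ℕ) : ℝ :=
  discrepancyNorm (k + 1) A - discrepancyNorm k A

theorem discrepancySeq_nonneg (A : Matrix (Fin n) (Fin n) ℂ) (k : ℕ) : 0 ≤ discrepancySeq A k :=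
  sub_nonneg.2 (discrepancyNorm_mono A k.le_succ)

theorem discrepancySeq_antitone (A : Matrix (Fin n) (Fin n) ℂ) : Antitone (discrepancySeq A) :=
  antitone_nat_of_succ_le fun k => by
    have := discrepancyNorm_concave k A
    simp only [discrepancySeq, add_assoc, Nat.reduceAdd]
    linarith

theorem sum_range_discrepancySeq (A : Matrix (Fin n) (Fin n) ℂ) (k : ℕ) :
    ∑ j ∈ Finset.range k, discrepancySeq A j = discrepancyNorm k A := by
  simp only [discrepancySeq]
  rw [Finset.sum_range_sub (fun j => discrepancyNorm j A), discrepancyNorm_zero, sub_zero]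

/-! ### Spectral projections and test matrices -/

/-- The projection onto the span of the first `p` columns of a unitary matrix `V`. -/
noncomputable def spectralProj (V : Matrix (Fin n) (Fin n) ℂ) (p : ℕ) : Matrix (Fin n) (Fin n) ℂ :=
  V * Matrix.diagonal (fun i => if i.val < p then 1 else 0) * star V

section Projections

variable {V : Matrix (Fin n) (Fin n) ℂ}

theorem conj_diagonal_add (d e : Fin n → ℂ) :
    V * Matrix.diagonal (d + e) * star V =
      V * Matrix.diagonal d * star V + V * Matrix.diagonal e * star V := by
  rw [← add_mul, ← mul_add, Matrix.diagonal_add]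
  rfl

theorem sum_indicator_lt_eq (p : ℕ) (hp : p ≤ n) :
    ∑ i : Fin n, (if i.val < p then (1 : ℂ) else 0) = p := by
  rw [Fin.sum_univ_eq_sum_range (fun i => if i < p then (1 : ℂ) else 0) n,
    ← Finset.sum_filter, Finset.sum_const, nsmul_one]
  have h : (Finset.range n).filter (· < p) = Finset.range p := by
    ext i
    simp only [Finset.mem_filter, Finset.mem_range]
    omega
  rw [h, Finset.card_range]

theorem spectralProj_mul_spectralProj (hV : V ∈ unitary (Matrix (Fin n) (Fin n) ℂ)) (p q : ℕ) :
    spectralProj V p * spectralProj V q = spectralProj V (min p q) := by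
  have : spectralProj V p * spectralProj V q =
      V * (Matrix.diagonal (fun i => if i.val < p then 1 else 0) * (star V * V) *
        Matrix.diagonal (fun i => if i.val < q then 1 else 0)) * star V := by
    simp only [spectralProj, mul_assoc]
  rw [this, Unitary.star_mul_self_of_mem hV, mul_one, Matrix.diagonal_mul_diagonal, spectralProj]
  congr 3
  funext i
  split_ifs <;> first | omega | simp

theorem trace_spectralProj (hV : V ∈ unitary (Matrix (Fin n) (Fin n) ℂ)) {p : ℕ} (hp : p ≤ n) :
    (spectralProj V p).trace = p := by
  rw [spectralProj, mul_assoc, Matrix.trace_mul_comm, mul_assoc,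
    Unitary.star_mul_self_of_mem hV, mul_one, Matrix.trace_diagonal, sum_indicator_lt_eq p hp]

theorem one_eq_conj_diagonal (hV : V ∈ unitary (Matrix (Fin n) (Fin n) ℂ)) :
    (1 : Matrix (Fin n) (Fin n) ℂ) = V * Matrix.diagonal (fun _ => 1) * star V := by
  rw [Matrix.diagonal_one, mul_one, Unitary.mul_star_self_of_mem hV]

theorem one_sub_spectralProj (hV : V ∈ unitary (Matrix (Fin n) (Fin n) ℂ)) (p : ℕ) :
    1 - spectralProj V p =
      V * Matrix.diagonal (fun i => if i.val < p then 0 else 1) * star V := by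
  rw [sub_eq_iff_eq_add', spectralProj, ← conj_diagonal_add, one_eq_conj_diagonal hV]
  congr 3
  funext i
  simp only [Pi.add_apply]
  split_ifs <;> simp

theorem norm_trace_spectralProj_mul_le (hV : V ∈ unitary (Matrix (Fin n) (Fin n) ℂ)) {p : ℕ}
    (hp : p ≤ n) (W : Matrix (Fin n) (Fin n) ℂ) :
    ‖(spectralProj V p * W).trace‖ ≤ p * ‖W‖ := by
  refine (norm_trace_unitary_diagonal_unitary_mul_le hV (Unitary.star_mem hV) _ W).trans_eq ?_
  congr 1
  have h (i : Fin n) : ‖(if i.val < p then (1 : ℂ) else 0)‖ =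
      (if i.val < p then (1 : ℂ) else 0).re := by split_ifs <;> simp
  simp only [h]
  rw [← Complex.re_sum, sum_indicator_lt_eq p hp, Complex.natCast_re]

theorem norm_trace_one_sub_spectralProj_mul_le (hV : V ∈ unitary (Matrix (Fin n) (Fin n) ℂ))
    {p : ℕ} (hp : p ≤ n) (W : Matrix (Fin n) (Fin n) ℂ) :
    ‖((1 - spectralProj V p) * W).trace‖ ≤ (n - p : ℕ) * ‖W‖ := by
  rw [one_sub_spectralProj hV]
  refine (norm_trace_unitary_diagonal_unitary_mul_le hV (Unitary.star_mem hV) _ W).trans_eq ?_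
  congr 1
  have h (i : Fin n) : ‖(if i.val < p then (0 : ℂ) else 1)‖ =
      (1 - (if i.val < p then (1 : ℂ) else 0)).re := by split_ifs <;> simp
  simp only [h]
  rw [← Complex.re_sum, Finset.sum_sub_distrib, sum_indicator_lt_eq p hp, Nat.cast_sub hp]
  simp

/-- The commutator with a projection E is half the commutator with the reflection 2E - 1, a
contraction; this saves the factor 2 of the naive bound. -/
theorem norm_commutator_spectralProj_le (hV : V ∈ unitary (Matrix (Fin n) (Fin n) ℂ)) (p : ℕ)
    (W : Matrix (Fin n) (Fin n) ℂ) :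
    ‖W * spectralProj V p - spectralProj V p * W‖ ≤ ‖W‖ := by
  set S := spectralProj V p - (1 - spectralProj V p) with hS
  have hS1 : ‖S‖ ≤ 1 := by
    have : S = V * Matrix.diagonal (fun i => if i.val < p then 1 else -1) * star V := by
      rw [hS, sub_eq_iff_eq_add, one_sub_spectralProj hV, spectralProj, ← conj_diagonal_add]
      congr 3
      funext i
      simp only [Pi.add_apply]
      split_ifs <;> simp
    rw [this]
    refine norm_unitary_diagonal_unitary_le hV (Unitary.star_mem hV) zero_le_one fun i => ?_
    split_ifs <;> simp
  have h : W * spectralProj V p - spectralProj V p * W = (1 / 2 : ℂ) • (W * S - S * W) := by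
    have : W * S - S * W = (2 : ℂ) • (W * spectralProj V p - spectralProj V p * W) := by
      rw [hS, two_smul]; noncomm_ring
    rw [this, smul_smul]; norm_num
  rw [h, norm_smul]
  have h1 := norm_sub_le (W * S) (S * W)
  have h2 := (norm_mul_le W S).trans (mul_le_of_le_one_right (norm_nonneg W) hS1)
  have h3 := (norm_mul_le S W).trans (mul_le_of_le_one_left (norm_nonneg W) hS1)
  norm_num
  linarith

/-- The commutator of a spectral projection with a contraction of trace norm at most `k`. -/
theorem commutator_spectralProj_mem_tracelessBall
    (hV : V ∈ unitary (Matrix (Fin n) (Fin n) ℂ)) {p k : ℕ} (hp : p ≤ n)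
    {U : Matrix (Fin n) (Fin n) ℂ} (hU : ‖U‖ ≤ 1)
    (hUk : ∀ W : Matrix (Fin n) (Fin n) ℂ, ‖(U * W).trace‖ ≤ k * ‖W‖) :
    U * spectralProj V p - spectralProj V p * U ∈
      tracelessBall n (min k (2 * min p (n - p))) := by
  set E := spectralProj V p with hE
  have htr : (U * E - E * U).trace = 0 := by
    rw [Matrix.trace_sub, Matrix.trace_mul_comm, sub_self]
  refine mem_tracelessBall_iff.2
    ⟨(norm_commutator_spectralProj_le hV p U).trans hU, fun W => ?_, htr⟩
  have hUW : ‖U * W‖ ≤ ‖W‖ :=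
    (norm_mul_le _ _).trans (mul_le_of_le_one_left (norm_nonneg W) hU)
  have hWU : ‖W * U‖ ≤ ‖W‖ :=
    (norm_mul_le _ _).trans (mul_le_of_le_one_right (norm_nonneg W) hU)
  -- The commutator with `E` is moved onto `W`, where it does not increase the norm.
  have h1 : ‖((U * E - E * U) * W).trace‖ ≤ k * ‖W‖ := by
    have : ((U * E - E * U) * W).trace = (U * -(W * E - E * W)).trace := by
      rw [sub_mul, neg_sub, mul_sub, Matrix.trace_sub, Matrix.trace_sub, mul_assoc, mul_assoc E,
        Matrix.trace_mul_comm E, mul_assoc]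
    rw [this]
    refine (hUk _).trans (mul_le_mul_of_nonneg_left ?_ (Nat.cast_nonneg k))
    rw [norm_neg]
    exact norm_commutator_spectralProj_le hV p W
  have h4 : ((U * E - E * U) * W).trace = (E * (W * U - U * W)).trace := by
    rw [sub_mul, mul_sub, Matrix.trace_sub, Matrix.trace_sub, mul_assoc, mul_assoc,
      Matrix.trace_mul_comm U, mul_assoc]
  have h2 : ‖((U * E - E * U) * W).trace‖ ≤ p * (2 * ‖W‖) := by
    rw [h4]
    refine (norm_trace_spectralProj_mul_le hV hp _).trans
      (mul_le_mul_of_nonneg_left ?_ (Nat.cast_nonneg p))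
    linarith [norm_sub_le (W * U) (U * W)]
  -- Replacing `E` by `1 - E` only changes the sign of the commutator, so its rank counts as well.
  have h3 : ‖((U * E - E * U) * W).trace‖ ≤ (n - p : ℕ) * (2 * ‖W‖) := by
    have : ((U * E - E * U) * W).trace = ((1 - E) * (U * W - W * U)).trace := by
      rw [h4, sub_mul, one_mul, Matrix.trace_sub, Matrix.trace_sub, Matrix.trace_mul_comm U W,
        sub_self, zero_sub, ← Matrix.trace_neg, ← mul_neg, neg_sub]
    rw [this]
    refine (norm_trace_one_sub_spectralProj_mul_le hV hp _).trans
      (mul_le_mul_of_nonneg_left ?_ (Nat.cast_nonneg _))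
    linarith [norm_sub_le (U * W) (W * U)]
  rcases min_choice k (2 * min p (n - p)) with h | h
  · rw [h]; exact h1
  · rw [h]
    rcases min_choice p (n - p) with h | h <;> rw [h] <;> push_cast [-Nat.cast_sub] <;> linarith

/-- The difference of the projections onto the first `p` and the last `p` columns of `V`. -/
theorem spectralProj_add_sub_one_mem_tracelessBall
    (hV : V ∈ unitary (Matrix (Fin n) (Fin n) ℂ)) {p : ℕ} (hp : p ≤ n) {z : ℂ} (hz : ‖z‖ = 1) :
    z • (spectralProj V p + spectralProj V (n - p) - 1) ∈ tracelessBall n (2 * p) := by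
  refine mem_tracelessBall_iff.2 ⟨?_, fun W => ?_, ?_⟩
  · rw [norm_smul, hz, one_mul]
    have : spectralProj V p + spectralProj V (n - p) - 1 = V * Matrix.diagonal
        (fun i => (if i.val < p then 1 else 0) + (if i.val < n - p then 1 else 0) - 1) *
        star V := by
      rw [sub_eq_iff_eq_add, one_eq_conj_diagonal hV, spectralProj, spectralProj,
        ← conj_diagonal_add, ← conj_diagonal_add]
      congr 3
      funext i
      simp only [Pi.add_apply]
      ring
    rw [this]
    refine norm_unitary_diagonal_unitary_le hV (Unitary.star_mem hV) zero_le_one fun i => ?_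
    split_ifs <;> simp
  · have h1 := norm_trace_spectralProj_mul_le hV hp W
    have h2 := norm_trace_one_sub_spectralProj_mul_le hV (Nat.sub_le n p) W
    rw [Nat.sub_sub_self hp] at h2
    have : spectralProj V p + spectralProj V (n - p) - 1 =
      spectralProj V p - (1 - spectralProj V (n - p)) := by abel
    rw [smul_mul_assoc, Matrix.trace_smul, norm_smul, hz, one_mul, this, sub_mul,
      Matrix.trace_sub]
    push_cast
    linarith [norm_sub_le (spectralProj V p * W).trace ((1 - spectralProj V (n - p)) * W).trace]
  · rw [Matrix.trace_smul, Matrix.trace_sub, Matrix.trace_add, trace_spectralProj hV hp,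
      trace_spectralProj hV (Nat.sub_le n p), Matrix.trace_one, Nat.cast_sub hp]
    simp

theorem trace_spectralProj_mul_eq (hV : V ∈ unitary (Matrix (Fin n) (Fin n) ℂ)) {i p : ℕ}
    (hi : i ≤ n) :
    (spectralProj V i * (spectralProj V p + spectralProj V (n - p) - 1)).trace =
      ((min i p : ℕ) : ℂ) + (min i (n - p) : ℕ) - i := by
  rw [mul_sub, mul_add, mul_one, spectralProj_mul_spectralProj hV,
    spectralProj_mul_spectralProj hV, Matrix.trace_sub, Matrix.trace_add,
    trace_spectralProj hV ((min_le_left _ _).trans hi),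
    trace_spectralProj hV ((min_le_left _ _).trans hi), trace_spectralProj hV hi]

end Projections

/-! ### Abel summation and rearrangement -/

/-- If the partial sums of `a` are bounded by those of `b`, so are the partial sums weighted by a
nonnegative decreasing sequence. -/
theorem sum_range_mul_le_of_sum_range_le {a b d : ℕ → ℝ} {k : ℕ} (hd : Antitone d)
    (hd0 : ∀ j, 0 ≤ d j)
    (h : ∀ m ≤ k, ∑ j ∈ Finset.range m, a j ≤ ∑ j ∈ Finset.range m, b j) :
    ∑ j ∈ Finset.range k, a j * d j ≤ ∑ j ∈ Finset.range k, b j * d j := by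
  have key : ∀ m ≤ k, (∑ j ∈ Finset.range m, (b j - a j)) * d m ≤
      ∑ j ∈ Finset.range m, (b j - a j) * d j := by
    intro m
    induction m with
    | zero => simp
    | succ m ih =>
      intro hm
      have h1 := ih (by omega)
      have h2 : 0 ≤ ∑ j ∈ Finset.range (m + 1), (b j - a j) := by
        rw [Finset.sum_sub_distrib]; exact sub_nonneg.2 (h _ hm)
      refine (mul_le_mul_of_nonneg_left (hd m.le_succ) h2).trans ?_
      rw [Finset.sum_range_succ, Finset.sum_range_succ, add_mul]
      linarith
  have h1 := key k le_rfl
  have h2 : 0 ≤ ∑ j ∈ Finset.range k, (b j - a j) := by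
    rw [Finset.sum_sub_distrib]; exact sub_nonneg.2 (h _ le_rfl)
  have h3 := (mul_nonneg h2 (hd0 k)).trans h1
  simp only [sub_mul, Finset.sum_sub_distrib] at h3
  linarith

theorem sum_fin_filter_lt_eq_sum_range (f : ℕ → ℝ) {k : ℕ} (hk : k ≤ n) :
    ∑ i : Fin n with i.val < k, f i = ∑ j ∈ Finset.range k, f j := by
  rw [Finset.sum_filter, Fin.sum_univ_eq_sum_range (fun i => if i < k then f i else 0) n,
    ← Finset.sum_filter]
  congr 1
  ext i
  simp only [Finset.mem_filter, Finset.mem_range]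
  omega

theorem decreasing_eq_self {x : Fin n → ℝ} (hx : Antitone x) : decreasing x = x := by
  have h : Monotone (OrderDual.toDual ∘ x) := fun _ _ h => hx h
  rw [decreasing, Tuple.sort_eq_refl_iff_monotone.2 h]
  rfl

/-! ### The commutator estimate -/

section Commutator

variable {V A : Matrix (Fin n) (Fin n) ℂ} {c z : ℂ} {g : ℕ → ℝ}

/-- The scalar `c` commutes with everything, and the phase `z` is absorbed into the dual matrix `U`,
on which only norm bounds are imposed. -/
theorem kyFanNorm_commutator_le (hV : V ∈ unitary (Matrix (Fin n) (Fin n) ℂ)) (hz : ‖z‖ = 1)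
    (hg : ∀ i, 0 ≤ g i)
    (hA : A = c • 1 + z • ∑ i ∈ Finset.range n, (g i : ℂ) • spectralProj V (i + 1))
    (B : Matrix (Fin n) (Fin n) ℂ) (k : ℕ) :
    kyFanNorm k (A * B - B * A) ≤ ∑ i ∈ Finset.range n,
      g i * discrepancyNorm (min k (2 * min (i + 1) (n - (i + 1)))) B := by
  obtain ⟨U, hU, hUk, htr⟩ := exists_trace_eq_kyFanNorm k (A * B - B * A)
  have hzU : ‖z • U‖ ≤ 1 := by rwa [norm_smul, hz, one_mul]
  have hzUk (W : Matrix (Fin n) (Fin n) ℂ) : ‖(z • U * W).trace‖ ≤ k * ‖W‖ := by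
    rw [smul_mul_assoc, Matrix.trace_smul, norm_smul, hz, one_mul]
    exact hUk W
  have h1 : ((A * B - B * A) * U).trace = (B * (U * A - A * U)).trace := by
    rw [sub_mul, mul_sub, Matrix.trace_sub, Matrix.trace_sub, mul_assoc,
      Matrix.trace_mul_comm A, mul_assoc, mul_assoc]
  have h2 : U * A - A * U = ∑ i ∈ Finset.range n, (g i : ℂ) •
      ((z • U) * spectralProj V (i + 1) - spectralProj V (i + 1) * (z • U)) := by
    rw [hA, mul_add, add_mul]
    simp only [mul_smul_comm, smul_mul_assoc, mul_one, one_mul, Finset.mul_sum, Finset.sum_mul,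
      Finset.smul_sum, smul_sub, Finset.sum_sub_distrib, add_sub_add_left_eq_sub, smul_comm z]
  rw [h1, h2, Finset.mul_sum, Matrix.trace_sum] at htr
  rw [← Complex.ofReal_re (kyFanNorm k _), ← htr, Complex.re_sum]
  refine Finset.sum_le_sum fun i hi => ?_
  rw [mul_smul_comm, Matrix.trace_smul, smul_eq_mul, Complex.re_ofReal_mul]
  exact mul_le_mul_of_nonneg_left (le_discrepancyNorm
    (commutator_spectralProj_mem_tracelessBall hV (by simpa using hi) hzU hzUk)) (hg i)

/-- Pairing a rank-r layer with the top-minus-bottom difference of rank p gives min(p, n - p, r, n -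
r). The factor `star z` cancels the phase of `A`, and the scalar part drops out as the test matrix
is traceless. -/
theorem sum_min_le_two_mul_discrepancyNorm (hV : V ∈ unitary (Matrix (Fin n) (Fin n) ℂ))
    (hz : ‖z‖ = 1) (hg : ∀ i, 0 ≤ g i)
    (hA : A = c • 1 + z • ∑ i ∈ Finset.range n, (g i : ℂ) • spectralProj V (i + 1))
    {m : ℕ} (hm : m ≤ n) :
    ∑ i ∈ Finset.range n, g i * (min m (2 * min (i + 1) (n - (i + 1))) : ℕ) ≤
      2 * discrepancyNorm m A := by
  have hz' : ‖star z‖ = 1 := by rwa [norm_star]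
  have hzz : z * star z = 1 := by
    rw [Complex.star_def, Complex.mul_conj, Complex.normSq_eq_norm_sq, hz]; simp
  have hA' (p : ℕ) (hp : p ≤ n) :
      (A * (star z • (spectralProj V p + spectralProj V (n - p) - 1))).trace =
        ((∑ i ∈ Finset.range n,
          g i * (((min (i + 1) p : ℕ) : ℝ) + (min (i + 1) (n - p) : ℕ) - (i + 1 : ℕ)) : ℝ) : ℂ) := by
    have h0 := (mem_tracelessBall_iff.1 (spectralProj_add_sub_one_mem_tracelessBall hV hp hz')).2.2
    rw [hA, add_mul, Matrix.trace_add, smul_mul_assoc, one_mul, Matrix.trace_smul, h0, smul_zero,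
      zero_add, smul_mul_assoc, mul_smul_comm, smul_smul, hzz, one_smul, Finset.sum_mul,
      Matrix.trace_sum]
    rw [Complex.ofReal_sum]
    refine Finset.sum_congr rfl fun i hi => ?_
    rw [smul_mul_assoc, Matrix.trace_smul, trace_spectralProj_mul_eq hV (by simpa using hi)]
    simp only [Complex.ofReal_mul, Complex.ofReal_sub, Complex.ofReal_add, Complex.ofReal_natCast,
      smul_eq_mul]
  -- Averaging the tests with p = ⌊m/2⌋ and p = ⌈m/2⌉, of levels 2⌊m/2⌋ and 2⌈m/2⌉, gives exactly
  -- level `m`, also for odd `m`.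
  have hp : m / 2 ≤ n := by omega
  have hq : m - m / 2 ≤ n := by omega
  have h := le_discrepancyNorm (A := A) (midpoint_mem_tracelessBall (k := m) (by omega)
    (spectralProj_add_sub_one_mem_tracelessBall hV hp hz')
    (spectralProj_add_sub_one_mem_tracelessBall hV hq hz'))
  rw [mul_smul_comm, Matrix.trace_smul, mul_add, Matrix.trace_add, hA' _ hp, hA' _ hq,
    ← Complex.ofReal_add, smul_eq_mul, ← Finset.sum_add_distrib] at h
  have h2 : (1 / 2 : ℂ) = ((1 / 2 : ℝ) : ℂ) := by norm_num
  rw [h2, Complex.re_ofReal_mul, Complex.ofReal_re] at h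
  rw [one_div, inv_mul_le_iff₀ zero_lt_two] at h
  refine h.trans' ?_
  refine Finset.sum_le_sum fun i hi => ?_
  rw [← mul_add]
  refine mul_le_mul_of_nonneg_left ?_ (hg i)
  have hi' := Finset.mem_range.1 hi
  have : min m (2 * min (i + 1) (n - (i + 1))) + 2 * (i + 1) ≤ min (i + 1) (m / 2) +
      min (i + 1) (n - m / 2) + (min (i + 1) (m - m / 2) + min (i + 1) (n - (m - m / 2))) := by
    omega
  have : ((min m (2 * min (i + 1) (n - (i + 1))) : ℕ) : ℝ) + 2 * (i + 1 : ℕ) ≤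
      (min (i + 1) (m / 2) : ℕ) + (min (i + 1) (n - m / 2) : ℕ) +
        ((min (i + 1) (m - m / 2) : ℕ) + (min (i + 1) (n - (m - m / 2)) : ℕ)) := by
    exact_mod_cast this
  linarith

theorem kyFanNorm_commutator_le_sum (hV : V ∈ unitary (Matrix (Fin n) (Fin n) ℂ))
    (hz : ‖z‖ = 1) (hg : ∀ i, 0 ≤ g i)
    (hA : A = c • 1 + z • ∑ i ∈ Finset.range n, (g i : ℂ) • spectralProj V (i + 1))
    (B : Matrix (Fin n) (Fin n) ℂ) {k : ℕ} (hk : k ≤ n) :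
    kyFanNorm k (A * B - B * A) ≤
      ∑ j ∈ Finset.range k, 2 * discrepancySeq A j * discrepancySeq B j := by
  let q (i : ℕ) : ℕ := 2 * min (i + 1) (n - (i + 1))
  have hsum (m i : ℕ) (f : ℕ → ℝ) : ∑ j ∈ Finset.range (min m (q i)), f j =
      ∑ j ∈ Finset.range m, if j < q i then f j else 0 := by
    rw [← Finset.sum_filter]
    congr 1
    ext j
    simp
  -- Layer-cake exchange: the weight of δⱼ(B) is the total gap over the layers with `j < q i`.
  have h1 : ∑ i ∈ Finset.range n, g i * discrepancyNorm (min k (q i)) B =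
      ∑ j ∈ Finset.range k,
        (∑ i ∈ Finset.range n, if j < q i then g i else 0) * discrepancySeq B j := by
    simp only [Finset.sum_mul]
    rw [Finset.sum_comm]
    refine Finset.sum_congr rfl fun i _ => ?_
    rw [← sum_range_discrepancySeq, hsum, Finset.mul_sum]
    refine Finset.sum_congr rfl fun j _ => ?_
    split_ifs <;> simp
  refine ((kyFanNorm_commutator_le hV hz hg hA B k).trans_eq h1).trans
    (sum_range_mul_le_of_sum_range_le (discrepancySeq_antitone B) (discrepancySeq_nonneg B)
      fun m hm => ?_)
  rw [← Finset.mul_sum, sum_range_discrepancySeq, Finset.sum_comm]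
  refine le_of_eq_of_le (Finset.sum_congr rfl fun i _ => ?_)
    (sum_min_le_two_mul_discrepancyNorm hV hz hg hA (hm.trans hk))
  rw [← hsum, Finset.sum_const, Finset.card_range, nsmul_eq_mul, mul_comm]

end Commutator

/-! ### Hermitian and collinear normal matrices in layered form -/

theorem exists_eq_sum_spectralProj {H : Matrix (Fin n) (Fin n) ℂ} (hH : H.IsHermitian) :
    ∃ V ∈ unitary (Matrix (Fin n) (Fin n) ℂ), ∃ (g : ℕ → ℝ) (c : ℂ), (∀ i, 0 ≤ g i) ∧
      H = c • 1 + ∑ i ∈ Finset.range n, (g i : ℂ) • spectralProj V (i + 1) := by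
  rcases Nat.eq_zero_or_pos n with rfl | hn
  · exact ⟨1, one_mem _, 0, 0, fun _ => le_rfl, Subsingleton.elim _ _⟩
  have hfin : Module.finrank ℂ (EuclideanSpace ℂ (Fin n)) = n := by simp
  have hS : (Matrix.toEuclideanLin H).IsSymmetric := Matrix.isSymmetric_toEuclideanLin_iff.2 hH
  let b := hS.eigenvectorBasis hfin
  -- Clamping the index extends the eigenvalues by the smallest one, so `l n` is that eigenvalue and
  -- the last gap is zero.
  let l : ℕ → ℝ := fun i => hS.eigenvalues hfin ⟨min i (n - 1), by omega⟩
  have hl : Antitone l := fun i j hij => hS.eigenvalues_antitone hfin (by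
    simp only [Fin.mk_le_mk]; omega)
  have hln (i : Fin n) : l i = hS.eigenvalues hfin i := by
    simp only [l]
    congr 1
    ext
    simp only
    omega
  have hV := orthonormalBasis_columns_mem_unitary b
  refine ⟨_, hV, fun i => l i - l (i + 1), l n, fun i => sub_nonneg.2 (hl i.le_succ), ?_⟩
  set V : Matrix (Fin n) (Fin n) ℂ := Matrix.of (fun i j => b j i) with hVdef
  have key : H * V = V * Matrix.diagonal (fun i : Fin n => (l i : ℂ)) := by
    ext i j
    have h := congrArg (fun x : EuclideanSpace ℂ (Fin n) => x i)
      (hS.apply_eigenvectorBasis hfin j)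
    simp only [Matrix.toLpLin_apply, PiLp.smul_apply, smul_eq_mul] at h
    rw [Matrix.mul_diagonal, hVdef, Matrix.of_apply, mul_comm, hln]
    exact h
  have hHV : H = V * Matrix.diagonal (fun i : Fin n => (l i : ℂ)) * star V := by
    rw [← key, mul_assoc, Unitary.mul_star_self_of_mem hV, mul_one]
  have hd : Matrix.diagonal (fun i : Fin n => (l i : ℂ)) = (l n : ℂ) • 1 +
      ∑ i ∈ Finset.range n, ((l i - l (i + 1) : ℝ) : ℂ) •
        Matrix.diagonal (fun j : Fin n => if j.val < i + 1 then (1 : ℂ) else 0) := by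
    ext a b
    rw [Matrix.add_apply, Matrix.sum_apply, Matrix.smul_apply]
    simp only [Matrix.smul_apply, Matrix.diagonal_apply, Matrix.one_apply, smul_eq_mul]
    split_ifs with hab
    · have h : ∑ i ∈ Finset.range n, ((l i - l (i + 1) : ℝ) : ℂ) *
          (if a.val < i + 1 then (1 : ℂ) else 0) =
          ∑ i ∈ Finset.Ico a.val n, ((l i - l (i + 1) : ℝ) : ℂ) := by
        simp only [mul_ite, mul_one, mul_zero]
        rw [← Finset.sum_filter]
        congr 1
        ext i
        simp only [Finset.mem_filter, Finset.mem_range, Finset.mem_Ico]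
        omega
      rw [h, ← Complex.ofReal_sum, ← neg_neg (∑ i ∈ Finset.Ico a.val n, (l i - l (i + 1))),
        ← Finset.sum_neg_distrib]
      simp only [neg_sub]
      rw [Finset.sum_Ico_sub l a.2.le]
      push_cast
      ring
    · simp
  conv_lhs => rw [hHV, hd, mul_add, add_mul, mul_smul_comm, smul_mul_assoc, mul_one,
    Unitary.mul_star_self_of_mem hV, Finset.mul_sum, Finset.sum_mul]
  simp only [mul_smul_comm, smul_mul_assoc]
  rfl

/-- An affine map z⁻¹(x - c) carries the line to the real axis; applied to `B` by functional
calculus it yields a Hermitian matrix. -/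
theorem exists_eq_smul_isHermitian {B : Matrix (Fin n) (Fin n) ℂ} (hB : IsStarNormal B)
    (hs : Collinear ℝ (spectrum ℂ B)) :
    ∃ (c z : ℂ) (H : Matrix (Fin n) (Fin n) ℂ), ‖z‖ = 1 ∧ H.IsHermitian ∧ B = c • 1 + z • H := by
  obtain ⟨c, v, hcv⟩ := (collinear_iff_exists_forall_eq_smul_vadd _).1 hs
  obtain ⟨z, hz, hvz⟩ : ∃ z : ℂ, ‖z‖ = 1 ∧ v = (‖v‖ : ℂ) * z := by
    rcases eq_or_ne v 0 with rfl | hv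
    -- With zero direction the spectrum has at most one point, and any phase works.
    · exact ⟨1, by simp, by simp⟩
    · have hv' : (‖v‖ : ℂ) ≠ 0 := by exact_mod_cast norm_ne_zero_iff.2 hv
      exact ⟨v / ‖v‖, by simp [hv], by field_simp⟩
  have hz0 : z ≠ 0 := by rintro rfl; simp at hz
  have hr : ∀ x ∈ spectrum ℂ B, ∃ r : ℝ, z⁻¹ * (x - c) = r := fun x hx => by
    obtain ⟨r, rfl⟩ := hcv x hx
    refine ⟨r * ‖v‖, ?_⟩
    rw [vadd_eq_add, add_sub_cancel_right, hvz, norm_mul, hz, mul_one, Complex.norm_real,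
      norm_norm, Complex.real_smul, Complex.ofReal_mul]
    field_simp
  refine ⟨c, z, cfc (fun x => z⁻¹ * (x - c)) B, hz, ?_, ?_⟩
  · rw [Matrix.IsHermitian, ← Matrix.star_eq_conjTranspose, ← cfc_star]
    refine cfc_congr fun x hx => ?_
    obtain ⟨r, h⟩ := hr x hx
    simp only [h, Complex.star_def, Complex.conj_ofReal]
  · rw [← cfc_const_mul z (fun x => z⁻¹ * (x - c)) B, ← Algebra.algebraMap_eq_smul_one,
      ← cfc_const_add c (fun x => z * (z⁻¹ * (x - c))) B]
    conv_lhs => rw [← cfc_id ℂ B]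
    refine cfc_congr fun x _ => ?_
    simp only [mul_inv_cancel_left₀ hz0, add_sub_cancel, id]

/-- Both vectors are already decreasing, so weak majorization is just the inequality of initial
sums. -/
theorem weaklyMajorizedBy_of_commutator {V A : Matrix (Fin n) (Fin n) ℂ} {c z : ℂ} {g : ℕ → ℝ}
    (hV : V ∈ unitary (Matrix (Fin n) (Fin n) ℂ))
    (hz : ‖z‖ = 1) (hg : ∀ i, 0 ≤ g i)
    (hA : A = c • 1 + z • ∑ i ∈ Finset.range n, (g i : ℂ) • spectralProj V (i + 1))
    (B : Matrix (Fin n) (Fin n) ℂ) :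
    WeaklyMajorizedBy (singularValues (A * B - B * A))
      (fun i => 2 * discrepancyValues A i * discrepancyValues B i) := by
  have hanti : Antitone fun i : Fin n => 2 * discrepancyValues A i * discrepancyValues B i :=
    fun i j h => mul_le_mul
      (mul_le_mul_of_nonneg_left (discrepancySeq_antitone A h) zero_le_two)
      (discrepancySeq_antitone B h) (discrepancySeq_nonneg B j)
      (mul_nonneg zero_le_two (discrepancySeq_nonneg A i))
  intro k _ hk
  rw [decreasing_eq_self (singularValues_antitone _), decreasing_eq_self hanti]
  exact (kyFanNorm_commutator_le_sum hV hz hg hA B hk).trans_eq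
    (sum_fin_filter_lt_eq_sum_range (fun j => 2 * discrepancySeq A j * discrepancySeq B j) hk).symm

end Discrepancy

end

theorem mainTheorem4 (n : ℕ) :
    (∀ A B : Matrix (Fin n) (Fin n) ℂ, A.IsHermitian →
      Discrepancy.WeaklyMajorizedBy
        (Discrepancy.singularValues (A * B - B * A))
        (fun i => 2 * Discrepancy.discrepancyValues A i * Discrepancy.discrepancyValues B i)) ∧
    (∀ A B : Matrix (Fin n) (Fin n) ℂ, IsStarNormal B → Collinear ℝ (spectrum ℂ B) →
      Discrepancy.WeaklyMajorizedBy
        (Discrepancy.singularValues (B * A - A * B))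
        (fun i => 2 * Discrepancy.discrepancyValues B i * Discrepancy.discrepancyValues A i)) := by
  refine ⟨fun A B hA => ?_, fun A B hB hs => ?_⟩
  · obtain ⟨V, hV, g, c, hg, h⟩ := Discrepancy.exists_eq_sum_spectralProj hA
    exact Discrepancy.weaklyMajorizedBy_of_commutator (c := c) (z := 1) hV norm_one hg
      (by rw [one_smul]; exact h) B
  · obtain ⟨c, z, H, hz, hH, rfl⟩ := Discrepancy.exists_eq_smul_isHermitian hB hs
    obtain ⟨V, hV, g, d, hg, rfl⟩ := Discrepancy.exists_eq_sum_spectralProj hH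
    exact Discrepancy.weaklyMajorizedBy_of_commutator (c := c + z * d) hV hz hg
      (by rw [smul_add, smul_smul, add_smul, add_assoc]) A
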